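/- **Theorem.** In every pre-Elgot category, every partial recursive function $f:\mathbb{N}^n\rightharpoonup\mathbb{N}$ ($n\ge 0$) is representable relative to the natural numbers algebra $(N,\iota)$. Here composition is written in diagrammatic order, and monoidal categories are not required to be strict (in the strict case all associators and unitors below are identities). The notions are as follows. * A *cocartesian monoidal category* is a symmetric monoidal category $(\mathbb{C},+,0,\sigma^+)$ with monoidal natural transformations $\mu_A:A+A\to A$ and $\eta_A:0\to A$ such that every $(A,\mu_A,\eta_A)$ is a commutative monoid. Then $A+B$ is a coproduct with coprojections $1_A+\eta_B$ and $\eta_A+1_B$ (up to unitors). * A *distributive monoidal category* is a category with a cocartesian monoidal structure $((+,0,\sigma^+),(\mu,\eta))$, a (not necessarily symmetric) monoidal structure $(\otimes,I)$, and natural isomorphisms $$\lambda^\bullet_A:0\otimes A\to 0,\quad \rho^\bullet_A:A\otimes 0\to 0,\quad \delta^l_{A,B,C}:A\otimes(B+C)\to (A\otimes B)+(A\otimes C),\quad \delta^r_{A,B,C}:(A+B)\otimes C\to (A\otimes C)+(B\otimes C)$$ satisfying the coherence axioms of a rig (tight bimonoidal) category: compatibility of $\delta^l,\delta^r$ with $\sigma^+$,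 with the associator and the unitors of $+$, with the associator and the unitors of $\otimes$, and with each other, and the corresponding axioms for $\lambda^\bullet,\rho^\bullet$. * A *trace* on a symmetric monoidal category $(\mathbb{C},+,0,\sigma^+)$ is a family of operations $\mathsf{Tr}^X_{A,B}:\mathbb{C}(A+X,B+X)\to\mathbb{C}(A,B)$ such that (up to associators and unitors) $\mathsf{Tr}^0(f)=f$; $\mathsf{Tr}^{X+Y}(f)=\mathsf{Tr}^X(\mathsf{Tr}^Y(f))$; $g\,\mathsf{Tr}^X(f)\,h=\mathsf{Tr}^X((g+1_X)f(h+1_X))$; $1_D+\mathsf{Tr}^X(f)=\mathsf{Tr}^X(1_D+f)$; $\mathsf{Tr}^X((1_A+h)f)=\mathsf{Tr}^Y(f(1_B+h))$ for $h:X\to Y$ and $f:A+Y\to B+X$; and $\mathsf{Tr}^A(\sigma^+_{A,A})=1_A$. * A *pre-Elgot category* is a distributive monoidal category together with a trace on its additive structure $(+,0,\sigma^+)$, an object $N$ and an isomorphism $\iota:I+N\to N$. No uniformity of the trace and no compatibility between the trace and $\otimes$ is required. * Let $z:I\to N$ and $s:N\to N$ be the composites of the two coprojections of $I+N$ with $\iota$,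 so that $[z,s]=\iota$. The *numerals* $\underline{k}:I\to N$ are defined by $\underline{0}=z$ and $\underline{k+1}=\underline{k}\,s$. A morphism $F:N^{n}\to N$, where $N^n=N\otimes\cdots\otimes N$ and $N^0=I$, *represents* the partial function $f:\mathbb{N}^n\rightharpoonup\mathbb{N}$ if for all $k_1,\dots,k_n,k\in\mathbb{N}$ $$f(k_1,\dots,k_n)=k\ \Longrightarrow\ (\underline{k_1}\otimes\cdots\otimes\underline{k_n})\,F=\underline{k},$$ with no requirement where $f$ is undefined; $f$ is *representable* if some morphism represents it. -/

import Mathlib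

open CategoryTheory MonoidalCategory

universe v u

namespace Elgot

section Symmetric

/-- A cocartesian structure on a symmetric monoidal category: monoidal natural transformations
`codiag` (`μ`) and `cozero` (`η`) making every object a commutative monoid. In this definition
the tensor product of Mathlib's notation is the one that is going to be the coproduct. -/
class CocartesianStructure (C : Type u) [Category.{v} C] [MonoidalCategory C]
    [SymmetricCategory C] where
  /-- the component `μ_A` -/
  codiag (A : C) : A ⊗ A ⟶ A
  /-- the component `η_A` -/
  cozero (A : C) : 𝟙_ C ⟶ A
  codiag_naturality {A B : C} (f : A ⟶ B) : codiag A ≫ f = (f ⊗ₘ f) ≫ codiag B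
  cozero_naturality {A B : C} (f : A ⟶ B) : cozero A ≫ f = cozero B
  codiag_unit : codiag (𝟙_ C) = (λ_ (𝟙_ C)).hom
  codiag_tensor (A B : C) : codiag (A ⊗ B) = tensorμ A B A B ≫ (codiag A ⊗ₘ codiag B)
  cozero_unit : cozero (𝟙_ C) = 𝟙 (𝟙_ C)
  cozero_tensor (A B : C) : cozero (A ⊗ B) = (λ_ (𝟙_ C)).inv ≫ (cozero A ⊗ₘ cozero B)
  codiag_assoc (A : C) :
    (codiag A ▷ A) ≫ codiag A = (α_ A A A).hom ≫ (A ◁ codiag A) ≫ codiag A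
  codiag_comm (A : C) : (β_ A A).hom ≫ codiag A = codiag A
  codiag_cozero (A : C) : (A ◁ cozero A) ≫ codiag A = (ρ_ A).hom

namespace CocartesianStructure

variable {C : Type u} [Category.{v} C] [MonoidalCategory C] [SymmetricCategory C]
  [CocartesianStructure C]

/-- The left coprojection `1 + η`. -/
def inl (A B : C) : A ⟶ A ⊗ B := (ρ_ A).inv ≫ (A ◁ cozero B)

/-- The right coprojection `η + 1`. -/
def inr (A B : C) : B ⟶ A ⊗ B := (λ_ B).inv ≫ (cozero A ▷ B)

end CocartesianStructure

/-- A trace on a symmetric monoidal category. -/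
class TraceStructure (C : Type u) [Category.{v} C] [MonoidalCategory C]
    [SymmetricCategory C] where
  /-- the operation `Tr^X_{A,B}` -/
  tr (X : C) {A B : C} (f : A ⊗ X ⟶ B ⊗ X) : A ⟶ B
  tr_unit {A B : C} (f : A ⊗ 𝟙_ C ⟶ B ⊗ 𝟙_ C) :
    tr (𝟙_ C) f = (ρ_ A).inv ≫ f ≫ (ρ_ B).hom
  tr_tensor {A B : C} (X Y : C) (f : A ⊗ (X ⊗ Y) ⟶ B ⊗ (X ⊗ Y)) :
    tr (X ⊗ Y) f = tr X (tr Y ((α_ A X Y).hom ≫ f ≫ (α_ B X Y).inv))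
  tr_naturality {A A' B B' : C} (X : C) (g : A' ⟶ A) (f : A ⊗ X ⟶ B ⊗ X) (h : B ⟶ B') :
    g ≫ tr X f ≫ h = tr X ((g ▷ X) ≫ f ≫ (h ▷ X))
  tr_superposing {A B : C} (D X : C) (f : A ⊗ X ⟶ B ⊗ X) :
    D ◁ tr X f = tr X ((α_ D A X).hom ≫ (D ◁ f) ≫ (α_ D B X).inv)
  tr_sliding {A B X Y : C} (h : X ⟶ Y) (f : A ⊗ Y ⟶ B ⊗ X) :
    tr X ((A ◁ h) ≫ f) = tr Y (f ≫ (B ◁ h))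
  tr_yanking (A : C) : tr A (β_ A A).hom = 𝟙 A

end Symmetric

/-- A second monoidal structure `(+, 0, σ⁺)` on a category, which is symmetric and cocartesian.
It is kept apart from the instance `MonoidalCategory C`, which is used for the multiplicative
structure `(⊗, I)`. -/
class AdditiveStructure (C : Type u) [Category.{v} C] where
  monoidal : MonoidalCategory C
  symmetric : @SymmetricCategory C _ monoidal
  cocartesian : @CocartesianStructure C _ monoidal symmetric

section AdditiveNotation

variable {C : Type u} [Category.{v} C] [S : AdditiveStructure C]

/-- `A + B` -/
abbrev addObj (A B : C) : C := S.monoidal.tensorObj A B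

variable (C) in
/-- the additive unit `0` -/
abbrev addUnit : C := S.monoidal.tensorUnit

/-- `f + g` -/
abbrev addHom {A B A' B' : C} (f : A ⟶ A') (g : B ⟶ B') : addObj A B ⟶ addObj A' B' :=
  S.monoidal.tensorHom f g

/-- the associator `(A + B) + D ≅ A + (B + D)` -/
abbrev addAssoc (A B D : C) : addObj (addObj A B) D ≅ addObj A (addObj B D) :=
  S.monoidal.associator A B D

/-- the unitor `0 + A ≅ A` -/
abbrev addLeftUnitor (A : C) : addObj (addUnit C) A ≅ A := S.monoidal.leftUnitor A

/-- the unitor `A + 0 ≅ A` -/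
abbrev addRightUnitor (A : C) : addObj A (addUnit C) ≅ A := S.monoidal.rightUnitor A

/-- the symmetry `σ⁺ : A + B ≅ B + A` -/
abbrev addBraiding (A B : C) : addObj A B ≅ addObj B A := S.symmetric.braiding A B

/-- the interchange `1 + σ⁺ + 1 : (A + B) + (A' + B') ⟶ (A + A') + (B + B')` -/
abbrev addMiddle (A B A' B' : C) :
    addObj (addObj A B) (addObj A' B') ⟶ addObj (addObj A A') (addObj B B') :=
  @tensorμ C _ S.monoidal S.symmetric.toBraidedCategory A B A' B'

/-- the left coprojection `A ⟶ A + B` -/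
abbrev addInl (A B : C) : A ⟶ addObj A B :=
  @CocartesianStructure.inl C _ S.monoidal S.symmetric S.cocartesian A B

/-- the right coprojection `B ⟶ A + B` -/
abbrev addInr (A B : C) : B ⟶ addObj A B :=
  @CocartesianStructure.inr C _ S.monoidal S.symmetric S.cocartesian A B

end AdditiveNotation

end Elgot

infixr:65 " ⊞ₒ " => Elgot.addObj
infixr:65 " ⊞ₕ " => Elgot.addHom

namespace Elgot

/-- A distributive monoidal category: a multiplicative monoidal structure `(⊗, I)` (the instance
`MonoidalCategory C`) and an additive cocartesian monoidal structure `(+, 0, σ⁺, μ, η)` (the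
instance `AdditiveStructure C`), with
natural isomorphisms `annL`, `annR` (annihilators) and `distL`, `distR` (distributors) that
satisfy the coherence axioms of a rig category. When both monoidal structures are strict, all
associators and unitors that occur below are identities. -/
class DistributiveMonoidalCategory (C : Type u) [Category.{v} C] [MonoidalCategory C]
    [AdditiveStructure C] where
  /-- the left annihilator `λ•` -/
  annL (A : C) : addUnit C ⊗ A ≅ addUnit C
  /-- the right annihilator `ρ•` -/
  annR (A : C) : A ⊗ addUnit C ≅ addUnit C
  /-- the left distributor `δˡ` -/
  distL (A B D : C) : A ⊗ (B ⊞ₒ D) ≅ (A ⊗ B) ⊞ₒ (A ⊗ D)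
  /-- the right distributor `δʳ` -/
  distR (A B D : C) : (A ⊞ₒ B) ⊗ D ≅ (A ⊗ D) ⊞ₒ (B ⊗ D)
  annL_naturality {A B : C} (f : A ⟶ B) :
    (addUnit C ◁ f) ≫ (annL B).hom = (annL A).hom
  annR_naturality {A B : C} (f : A ⟶ B) :
    (f ▷ addUnit C) ≫ (annR B).hom = (annR A).hom
  distL_naturality {A A' B B' D D' : C} (f : A ⟶ A') (g : B ⟶ B') (h : D ⟶ D') :
    (f ⊗ₘ (g ⊞ₕ h)) ≫ (distL A' B' D').hom =
      (distL A B D).hom ≫ ((f ⊗ₘ g) ⊞ₕ (f ⊗ₘ h))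
  distR_naturality {A A' B B' D D' : C} (f : A ⟶ A') (g : B ⟶ B') (h : D ⟶ D') :
    ((f ⊞ₕ g) ⊗ₘ h) ≫ (distR A' B' D').hom =
      (distR A B D).hom ≫ ((f ⊗ₘ h) ⊞ₕ (g ⊗ₘ h))
  distL_braiding (A B D : C) :
    (distL A B D).hom ≫ (addBraiding (A ⊗ B) (A ⊗ D)).hom =
      (A ◁ (addBraiding B D).hom) ≫ (distL A D B).hom
  distR_braiding (A B D : C) :
    (distR A B D).hom ≫ (addBraiding (A ⊗ D) (B ⊗ D)).hom =
      ((addBraiding A B).hom ▷ D) ≫ (distR B A D).hom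
  distR_addAssoc (A B D E : C) :
    (distR (A ⊞ₒ B) D E).hom ≫ ((distR A B E).hom ⊞ₕ 𝟙 (D ⊗ E)) ≫
        (addAssoc (A ⊗ E) (B ⊗ E) (D ⊗ E)).hom =
      ((addAssoc A B D).hom ▷ E) ≫ (distR A (B ⊞ₒ D) E).hom ≫
        (𝟙 (A ⊗ E) ⊞ₕ (distR B D E).hom)
  distL_addAssoc (A B D E : C) :
    (distL A (B ⊞ₒ D) E).hom ≫ ((distL A B D).hom ⊞ₕ 𝟙 (A ⊗ E)) ≫
        (addAssoc (A ⊗ B) (A ⊗ D) (A ⊗ E)).hom =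
      (A ◁ (addAssoc B D E).hom) ≫ (distL A B (D ⊞ₒ E)).hom ≫
        (𝟙 (A ⊗ B) ⊞ₕ (distL A D E).hom)
  distL_tensor (A B D E : C) :
    (distL (A ⊗ B) D E).hom ≫ ((α_ A B D).hom ⊞ₕ (α_ A B E).hom) =
      (α_ A B (D ⊞ₒ E)).hom ≫ (A ◁ (distL B D E).hom) ≫ (distL A (B ⊗ D) (B ⊗ E)).hom
  distR_tensor (A B D E : C) :
    ((distR A B D).hom ▷ E) ≫ (distR (A ⊗ D) (B ⊗ D) E).hom ≫
        ((α_ A D E).hom ⊞ₕ (α_ B D E).hom) =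
      (α_ (A ⊞ₒ B) D E).hom ≫ (distR A B (D ⊗ E)).hom
  distL_distR_assoc (A B D E : C) :
    ((distL A B D).hom ▷ E) ≫ (distR (A ⊗ B) (A ⊗ D) E).hom ≫
        ((α_ A B E).hom ⊞ₕ (α_ A D E).hom) =
      (α_ A (B ⊞ₒ D) E).hom ≫ (A ◁ (distR B D E).hom) ≫ (distL A (B ⊗ E) (D ⊗ E)).hom
  distL_distR_middle (A B D E : C) :
    (distL (A ⊞ₒ B) D E).hom ≫ ((distR A B D).hom ⊞ₕ (distR A B E).hom) ≫
        addMiddle (A ⊗ D) (B ⊗ D) (A ⊗ E) (B ⊗ E) =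
      (distR A B (D ⊞ₒ E)).hom ≫ ((distL A D E).hom ⊞ₕ (distL B D E).hom)
  annL_addUnit : (annL (addUnit C)).hom = (annR (addUnit C)).hom
  distL_annL (A B : C) :
    (distL (addUnit C) A B).hom ≫ ((annL A).hom ⊞ₕ (annL B).hom) ≫
        (addLeftUnitor (addUnit C)).hom =
      (annL (A ⊞ₒ B)).hom
  distR_annR (A B : C) :
    (distR A B (addUnit C)).hom ≫ ((annR A).hom ⊞ₕ (annR B).hom) ≫
        (addLeftUnitor (addUnit C)).hom =
      (annR (A ⊞ₒ B)).hom
  annL_unit : (annL (𝟙_ C)).hom = (ρ_ (addUnit C)).hom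
  annR_unit : (annR (𝟙_ C)).hom = (λ_ (addUnit C)).hom
  annR_tensor (A B : C) :
    (annR (A ⊗ B)).hom =
      (α_ A B (addUnit C)).hom ≫ (A ◁ (annR B).hom) ≫ (annR A).hom
  annR_annL_assoc (A B : C) :
    ((annR A).hom ▷ B) ≫ (annL B).hom =
      (α_ A (addUnit C) B).hom ≫ (A ◁ (annL B).hom) ≫ (annR A).hom
  annL_tensor (A B : C) :
    ((annL A).hom ▷ B) ≫ (annL B).hom =
      (α_ (addUnit C) A B).hom ≫ (annL (A ⊗ B)).hom
  distL_addLeftUnitor (A B : C) :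
    (distL A (addUnit C) B).hom ≫ ((annR A).hom ⊞ₕ 𝟙 (A ⊗ B)) ≫
        (addLeftUnitor (A ⊗ B)).hom =
      A ◁ (addLeftUnitor B).hom
  distR_addLeftUnitor (A B : C) :
    (distR (addUnit C) B A).hom ≫ ((annL A).hom ⊞ₕ 𝟙 (B ⊗ A)) ≫
        (addLeftUnitor (B ⊗ A)).hom =
      (addLeftUnitor B).hom ▷ A
  distL_addRightUnitor (A B : C) :
    (distL A B (addUnit C)).hom ≫ (𝟙 (A ⊗ B) ⊞ₕ (annR A).hom) ≫
        (addRightUnitor (A ⊗ B)).hom =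
      A ◁ (addRightUnitor B).hom
  distR_addRightUnitor (A B : C) :
    (distR B (addUnit C) A).hom ≫ (𝟙 (B ⊗ A) ⊞ₕ (annL A).hom) ≫
        (addRightUnitor (B ⊗ A)).hom =
      (addRightUnitor B).hom ▷ A
  distL_leftUnitor (A B : C) :
    (distL (𝟙_ C) A B).hom ≫ ((λ_ A).hom ⊞ₕ (λ_ B).hom) = (λ_ (A ⊞ₒ B)).hom
  distR_rightUnitor (A B : C) :
    (distR A B (𝟙_ C)).hom ≫ ((ρ_ A).hom ⊞ₕ (ρ_ B).hom) = (ρ_ (A ⊞ₒ B)).hom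

/-- A pre-Elgot category: a distributive monoidal category with a trace on the additive
structure and an isomorphism `ι : I + N ≅ N`. -/
class PreElgotCategory (C : Type u) [Category.{v} C] [MonoidalCategory C]
    [AdditiveStructure C] extends DistributiveMonoidalCategory C where
  trace : @TraceStructure C _ AdditiveStructure.monoidal AdditiveStructure.symmetric
  /-- the object `N` -/
  N : C
  /-- the isomorphism `ι : I + N ≅ N` -/
  ι : 𝟙_ C ⊞ₒ N ≅ N

/-- A natural numbers algebra in a monoidal category. -/
structure NatAlgebra (C : Type u) [Category.{v} C] [MonoidalCategory C] where
  N : C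
  zero : 𝟙_ C ⟶ N
  succ : N ⟶ N

section Representability

variable {C : Type u} [Category.{v} C] [MonoidalCategory C]

/-- The numeral `I ⟶ N` of a natural number. -/
def NatAlgebra.numeral (M : NatAlgebra C) : ℕ → (𝟙_ C ⟶ M.N)
  | 0 => M.zero
  | k + 1 => M.numeral k ≫ M.succ

/-- The tensor power `A ⊗ (A ⊗ ⋯ (A ⊗ I))` with `n` factors `A`. -/
def tensorPow (A : C) : ℕ → C
  | 0 => 𝟙_ C
  | n + 1 => A ⊗ tensorPow A n

/-- The tensor product `k₁ ⊗ ⋯ ⊗ kₙ : I ⟶ Nⁿ` of numerals. -/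
def NatAlgebra.numerals (M : NatAlgebra C) :
    (n : ℕ) → List.Vector ℕ n → (𝟙_ C ⟶ tensorPow M.N n)
  | 0, _ => 𝟙 (𝟙_ C)
  | n + 1, k => (λ_ (𝟙_ C)).inv ≫ (M.numeral k.head ⊗ₘ M.numerals n k.tail)

/-- The morphism `F : Nⁿ ⟶ N` represents the partial function `f` with respect to `M`. -/
def NatAlgebra.Represents (M : NatAlgebra C) {n : ℕ} (F : tensorPow M.N n ⟶ M.N)
    (f : List.Vector ℕ n →. ℕ) : Prop :=
  ∀ (k : List.Vector ℕ n) (m : ℕ), m ∈ f k → M.numerals n k ≫ F = M.numeral m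

/-- The partial function `f` is representable with respect to `M`. -/
def NatAlgebra.Representable (M : NatAlgebra C) {n : ℕ} (f : List.Vector ℕ n →. ℕ) : Prop :=
  ∃ F : tensorPow M.N n ⟶ M.N, M.Represents F f

end Representability

/-- The natural numbers algebra `(N, z, s)` with `[z, s] = ι` of a pre-Elgot category. -/
def PreElgotCategory.natAlgebra (C : Type u) [Category.{v} C] [MonoidalCategory C]
    [AdditiveStructure C] [PreElgotCategory C] : NatAlgebra C where
  N := PreElgotCategory.N
  zero := addInl (𝟙_ C) PreElgotCategory.N ≫ PreElgotCategory.ι.hom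
  succ := addInr (𝟙_ C) PreElgotCategory.N ≫ PreElgotCategory.ι.hom

end Elgot

/-!
The multiplicative structure of a pre-Elgot category need not be symmetric, and it offers neither
copying nor discarding. Still, the numerals can be copied, discarded and moved around, because each
of these operations is a loop counting a numeral down to zero.

*Loops.* A trace on a cocartesian category yields an iteration operator sending `f : A ⟶ B + A` to
`f† = Tr (μ f) : A ⟶ B`. It satisfies the fixpoint law `f [1, f†] = f†`
(`TraceStructure.comp_desc_iter`), which follows from naturality, superposing, sliding, vanishing
and yanking alone. The fixpoint law already determines the value of `f†` at every point from which
the iteration of `f` terminates, so uniformity of the trace is not needed.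

*Realizability.* A type `X` is coded by an object of the category with a point `I ⟶ obj` for each
element of `X`, and a morphism realizes a partial function if it maps points to points wherever the
function is defined. The type `ℕ` is coded by the numerals, `X × Y` through `⊗` and `X ⊕ Y` through
`+`. Realizable functions are closed under composition, products and sums; `ι⁻¹` realizes the case
distinction on `ℕ`, the distributor realizes `(X ⊕ Y) × Z ≃ X × Z ⊕ Y × Z`, and the iteration
operator realizes `PFun.fix`. Hence `(n, x) ↦ f^[n] x` is realizable when `f` is
(`Realizable.iterate`).

*Numbers behave classically.* Running such a for-loop with counter `n` makes `n ↦ (n, n)`, `n ↦ ()`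
and `(n, y) ↦ (y, n)` realizable, the last one for every coded type. These three properties pass to
products, hence to vectors of numbers (`IsClassical`), and so realizable functions on vectors can be
tupled. Primitive recursion is then a for-loop, unbounded search is an instance of `PFun.fix`, and
induction on `Nat.Partrec'` concludes.
-/

namespace Elgot

/-! ### Coproducts in cocartesian monoidal categories -/

namespace CocartesianStructure

variable {C : Type u} [Category.{v} C] [MonoidalCategory C] [SymmetricCategory C]
  [CocartesianStructure C] {A B D E A' B' : C}

theorem cozero_codiag (A : C) : (cozero A ▷ A) ≫ codiag A = (λ_ A).hom := by
  rw [← codiag_comm, ← Category.assoc, BraidedCategory.braiding_naturality_left, Category.assoc,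
    codiag_cozero, braiding_rightUnitor]

/-- The copairing `[f, g] = (f + g) μ`. -/
def desc (f : A ⟶ D) (g : B ⟶ D) : A ⊗ B ⟶ D := (f ⊗ₘ g) ≫ codiag D

@[simp]
theorem inl_desc (f : A ⟶ D) (g : B ⟶ D) : inl A B ≫ desc f g = f := by
  have h : (A ◁ cozero B) ≫ (f ⊗ₘ g) = (f ▷ 𝟙_ C) ≫ (D ◁ cozero D) := by
    rw [whiskerLeft_comp_tensorHom, cozero_naturality, MonoidalCategory.tensorHom_def]
  rw [inl, desc, Category.assoc, ← Category.assoc (A ◁ cozero B), h, Category.assoc,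
    codiag_cozero, rightUnitor_naturality, Iso.inv_hom_id_assoc]

@[simp]
theorem inr_desc (f : A ⟶ D) (g : B ⟶ D) : inr A B ≫ desc f g = g := by
  have h : (cozero A ▷ B) ≫ (f ⊗ₘ g) = (𝟙_ C ◁ g) ≫ (cozero D ▷ D) := by
    rw [whiskerRight_comp_tensorHom, cozero_naturality, tensorHom_def']
  rw [inr, desc, Category.assoc, ← Category.assoc (cozero A ▷ B), h, Category.assoc,
    cozero_codiag, leftUnitor_naturality, Iso.inv_hom_id_assoc]

/-- The coprojections are jointly epic because the codiagonal of `A + B` is, up to the interchange,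
the sum of the codiagonals of `A` and `B`. -/
theorem desc_inl_inr (A B : C) : desc (inl A B) (inr A B) = 𝟙 (A ⊗ B) := by
  have h1 : (β_ (𝟙_ C) (𝟙_ C)).hom = 𝟙 _ := by
    rw [← cancel_mono (λ_ (𝟙_ C)).hom, braiding_leftUnitor, unitors_equal, Category.id_comp]
  have h2 : tensorμ A (𝟙_ C) (𝟙_ C) B = 𝟙 _ := by
    simp [tensorμ, h1]
  have h3 : ((A ◁ cozero B) ⊗ₘ (cozero A ▷ B)) ≫ tensorμ A B A B =
      tensorμ A (𝟙_ C) (𝟙_ C) B ≫ ((A ◁ cozero A) ⊗ₘ (cozero B ▷ B)) := by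
    simp only [← id_tensorHom, ← tensorHom_id]
    exact tensorμ_natural _ _ _ _
  rw [desc, codiag_tensor, inl, inr, ← tensorHom_comp_tensorHom, Category.assoc,
    ← Category.assoc ((A ◁ cozero B) ⊗ₘ (cozero A ▷ B)), h3, h2, Category.id_comp,
    tensorHom_comp_tensorHom, codiag_cozero, cozero_codiag, tensorHom_comp_tensorHom]
  simp

theorem desc_comp (f : A ⟶ D) (g : B ⟶ D) (h : D ⟶ E) :
    desc f g ≫ h = desc (f ≫ h) (g ≫ h) := by
  rw [desc, desc, Category.assoc, codiag_naturality, tensorHom_comp_tensorHom_assoc]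

theorem desc_inl_comp_inr_comp (F : A ⊗ B ⟶ D) : desc (inl A B ≫ F) (inr A B ≫ F) = F := by
  rw [← desc_comp, desc_inl_inr, Category.id_comp]

theorem hom_ext {F G : A ⊗ B ⟶ D} (h1 : inl A B ≫ F = inl A B ≫ G)
    (h2 : inr A B ≫ F = inr A B ≫ G) : F = G := by
  rw [← desc_inl_comp_inr_comp F, ← desc_inl_comp_inr_comp G, h1, h2]

@[simp]
theorem inl_tensorHom (f : A ⟶ A') (g : B ⟶ B') : inl A B ≫ (f ⊗ₘ g) = f ≫ inl A' B' := by
  rw [inl, Category.assoc, whiskerLeft_comp_tensorHom, cozero_naturality,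
    MonoidalCategory.tensorHom_def, inl, rightUnitor_inv_naturality_assoc]

@[simp]
theorem inr_tensorHom (f : A ⟶ A') (g : B ⟶ B') : inr A B ≫ (f ⊗ₘ g) = g ≫ inr A' B' := by
  rw [inr, Category.assoc, whiskerRight_comp_tensorHom, cozero_naturality, tensorHom_def', inr,
    leftUnitor_inv_naturality_assoc]

theorem inl_braiding (A B : C) : inl A B ≫ (β_ A B).hom = inr B A := by
  rw [inl, Category.assoc, BraidedCategory.braiding_naturality_right, inr]
  simp

theorem inr_braiding (A B : C) : inr A B ≫ (β_ A B).hom = inl B A := by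
  rw [inr, Category.assoc, BraidedCategory.braiding_naturality_left, inl]
  simp

theorem inl_inl_associator (A B D : C) :
    inl A B ≫ inl (A ⊗ B) D ≫ (α_ A B D).hom = inl A (B ⊗ D) := by
  have h := MonoidalCategory.tensorHom_def (cozero B) (cozero D)
  simp only [inl, cozero_tensor, h]
  simp

theorem inr_inl_associator (A B D : C) :
    inr A B ≫ inl (A ⊗ B) D ≫ (α_ A B D).hom = inl B D ≫ inr A (B ⊗ D) := by
  have h1 : inr A B ≫ inl (A ⊗ B) D = inl B D ≫ (inr A B ▷ D) := by
    rw [inl, inl, Category.assoc, whisker_exchange, ← rightUnitor_inv_naturality_assoc]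
  have h2 : (inr A B ▷ D) ≫ (α_ A B D).hom = inr A (B ⊗ D) := by
    simp [inr]
  rw [← Category.assoc, h1, Category.assoc, h2]

theorem inr_associator (A B D : C) :
    inr (A ⊗ B) D ≫ (α_ A B D).hom = inr B D ≫ inr A (B ⊗ D) := by
  have h := tensorHom_def' (cozero A) (cozero B)
  simp only [inr, cozero_tensor, h]
  simp

/-! Once the structure morphisms are written as copairings, equations between them are checked by
rewriting with `desc_comp`, `inl_desc` and `inr_desc`. -/

theorem tensorHom_eq_desc (f : A ⟶ A') (g : B ⟶ B') :
    f ⊗ₘ g = desc (f ≫ inl A' B') (g ≫ inr A' B') :=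
  hom_ext (by simp) (by simp)

theorem whiskerRight_eq_desc (f : A ⟶ A') (B : C) :
    f ▷ B = desc (f ≫ inl A' B) (inr A' B) := by
  rw [← tensorHom_id, tensorHom_eq_desc, Category.id_comp]

theorem whiskerLeft_eq_desc (A : C) (g : B ⟶ B') :
    A ◁ g = desc (inl A B') (g ≫ inr A B') := by
  rw [← id_tensorHom, tensorHom_eq_desc, Category.id_comp]

theorem braiding_eq_desc (A B : C) : (β_ A B).hom = desc (inr B A) (inl B A) :=
  hom_ext (by rw [inl_braiding, inl_desc]) (by rw [inr_braiding, inr_desc])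

theorem associator_hom_eq_desc (A B D : C) :
    (α_ A B D).hom =
      desc (desc (inl A (B ⊗ D)) (inl B D ≫ inr A (B ⊗ D))) (inr B D ≫ inr A (B ⊗ D)) := by
  refine hom_ext (hom_ext ?_ ?_) ?_
  · simp [inl_inl_associator]
  · simp [inr_inl_associator]
  · simp [inr_associator]

theorem associator_inv_eq_desc (A B D : C) :
    (α_ A B D).inv =
      desc (inl A B ≫ inl (A ⊗ B) D) (desc (inr A B ≫ inl (A ⊗ B) D) (inr (A ⊗ B) D)) := by
  rw [← cancel_epi (α_ A B D).hom, Iso.hom_inv_id]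
  simp [associator_hom_eq_desc, desc_comp, desc_inl_inr, desc_inl_comp_inr_comp]

theorem inl_rightUnitor (A : C) : inl A (𝟙_ C) ≫ (ρ_ A).hom = 𝟙 A := by
  simp [inl, cozero_unit]

theorem inr_leftUnitor (A : C) : inr (𝟙_ C) A ≫ (λ_ A).hom = 𝟙 A := by
  simp [inr, cozero_unit]

/-- To recognize a coprojection into a sum with a summand `E ≅ 0` it suffices to compose with the
right unitor. -/
theorem eq_inl_of_comp_rightUnitor {F : A ⟶ A ⊗ E} (e : E ≅ 𝟙_ C)
    (h : F ≫ (𝟙 A ⊗ₘ e.hom) ≫ (ρ_ A).hom = 𝟙 A) : F = inl A E := by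
  rw [← cancel_mono ((𝟙 A ⊗ₘ e.hom) ≫ (ρ_ A).hom), h, ← Category.assoc, inl_tensorHom,
    Category.id_comp, inl_rightUnitor]

theorem eq_inr_of_comp_leftUnitor {F : A ⟶ E ⊗ A} (e : E ≅ 𝟙_ C)
    (h : F ≫ (e.hom ⊗ₘ 𝟙 A) ≫ (λ_ A).hom = 𝟙 A) : F = inr E A := by
  rw [← cancel_mono ((e.hom ⊗ₘ 𝟙 A) ≫ (λ_ A).hom), h, ← Category.assoc, inr_tensorHom,
    Category.id_comp, inr_leftUnitor]

end CocartesianStructure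

/-! ### Iteration from a trace -/

namespace TraceStructure

open CocartesianStructure

variable {C : Type u} [Category.{v} C] [MonoidalCategory C] [SymmetricCategory C]
  [TraceStructure C]

theorem tr_precomp {A A' B X : C} (g : A' ⟶ A) (f : A ⊗ X ⟶ B ⊗ X) :
    g ≫ tr X f = tr X ((g ▷ X) ≫ f) := by
  simpa using tr_naturality X g f (𝟙 B)

theorem tr_postcomp {A B B' X : C} (f : A ⊗ X ⟶ B ⊗ X) (h : B ⟶ B') :
    tr X f ≫ h = tr X (f ≫ (h ▷ X)) := by
  simpa using tr_naturality X (𝟙 A) f h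

variable [CocartesianStructure C] {A B : C}

/-- A loop that is never entered may be dropped. As the trace is not assumed to be uniform, this is
obtained by superposing: `[inl, f]` is `B + [0, f]` followed by a codiagonal, and the trace of
`[0, f]` is the unique morphism `0 ⟶ B`. -/
theorem tr_desc_inl (f : A ⟶ B ⊗ A) : tr A (desc (inl B A) f) = 𝟙 B := by
  have h : desc (inl B A) f = (inl B (𝟙_ C) ▷ A) ≫ ((α_ B (𝟙_ C) A).hom ≫
      (B ◁ desc (cozero _) f) ≫ (α_ B B A).inv) ≫ (desc (𝟙 B) (𝟙 B) ▷ A) := by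
    simp [whiskerRight_eq_desc, whiskerLeft_eq_desc, associator_hom_eq_desc,
      associator_inv_eq_desc, desc_comp, desc_inl_inr]
  rw [h, ← tr_naturality, ← tr_superposing]
  simp [whiskerLeft_eq_desc, desc_comp]

/-- A form of yanking: entering the loop and leaving it at once amounts to not entering it. The
first summand of `A + A` takes the detour through the loop, the second leaves directly. -/
theorem tr_yanking_codiag (A : C) :
    tr A (desc (desc (inr A A) (inl A A)) (inl A A)) = desc (𝟙 A) (𝟙 A) := by
  have h : desc (desc (inr A A) (inl A A)) (inl A A) = ((β_ A A).hom ▷ A) ≫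
      ((α_ A A A).hom ≫ (A ◁ (β_ A A).hom) ≫ (α_ A A A).inv) ≫ (desc (𝟙 A) (𝟙 A) ▷ A) := by
    simp [whiskerRight_eq_desc, whiskerLeft_eq_desc, associator_hom_eq_desc,
      associator_inv_eq_desc, braiding_eq_desc, desc_comp]
  rw [h, ← tr_naturality, ← tr_superposing, tr_yanking]
  simp [braiding_eq_desc, desc_comp]

/-- Entering the loop of `f` through the feedback is the same as applying `f` directly. Sliding the
codiagonal of the feedback around splits the loop in two, and the inner loop is removed by
yanking. -/
theorem tr_desc_inr (f : A ⟶ B ⊗ A) : tr A (desc (inr B A) f) = tr A (desc f f) := by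
  have h1 : desc (inr B A) f = ((β_ A A).hom ≫ (f ▷ A) ≫ (α_ B A A).hom) ≫
      (B ◁ desc (𝟙 A) (𝟙 A)) := by
    simp [whiskerRight_eq_desc, whiskerLeft_eq_desc, associator_hom_eq_desc,
      braiding_eq_desc, desc_comp, desc_inl_inr]
  have h2 : (α_ A A A).hom ≫ ((A ◁ desc (𝟙 A) (𝟙 A)) ≫ (β_ A A).hom ≫ (f ▷ A) ≫
      (α_ B A A).hom) ≫ (α_ B A A).inv = desc (desc (inr A A) (inl A A)) (inl A A) ≫ (f ▷ A) := by
    simp [whiskerRight_eq_desc, whiskerLeft_eq_desc, associator_hom_eq_desc,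
      associator_inv_eq_desc, braiding_eq_desc, desc_comp, desc_inl_comp_inr_comp]
  rw [h1, ← tr_sliding, tr_tensor, h2, ← tr_postcomp, tr_yanking_codiag, desc_comp,
    Category.id_comp]

/-- The iteration `f† : A ⟶ B` of `f : A ⟶ B + A`. -/
def iter (f : A ⟶ B ⊗ A) : A ⟶ B := tr A (desc f f)

/-- The fixpoint law. Both sides are expressed by the trace of `[1, f] : (B + A) + A ⟶ B + A`, which
is the identity on `B` and `f†` on `A`. -/
theorem comp_desc_iter (f : A ⟶ B ⊗ A) : f ≫ desc (𝟙 B) (iter f) = iter f := by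
  have h : desc (𝟙 B) (iter f) = tr A (desc (𝟙 _) f) := by
    refine hom_ext ?_ ?_
    · rw [inl_desc, tr_precomp, ← tr_desc_inl f, whiskerRight_eq_desc, desc_comp]
      simp
    · rw [inr_desc, tr_precomp, iter, ← tr_desc_inr f, whiskerRight_eq_desc, desc_comp]
      simp
  rw [h, tr_precomp, iter, whiskerRight_eq_desc, desc_comp]
  simp

end TraceStructure

/-! ### The additive structure, distributors and iteration -/

section Additive

variable {C : Type u} [Category.{v} C] [S : AdditiveStructure C] {A B D A' B' : C}

theorem addInl_addHom (f : A ⟶ A') (g : B ⟶ B') :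
    addInl A B ≫ (f ⊞ₕ g) = f ≫ addInl A' B' :=
  @CocartesianStructure.inl_tensorHom C _ S.monoidal S.symmetric S.cocartesian _ _ _ _ f g

theorem addInr_addHom (f : A ⟶ A') (g : B ⟶ B') :
    addInr A B ≫ (f ⊞ₕ g) = g ≫ addInr A' B' :=
  @CocartesianStructure.inr_tensorHom C _ S.monoidal S.symmetric S.cocartesian _ _ _ _ f g

theorem addInl_addRightUnitor (A : C) :
    addInl A (addUnit C) ≫ (addRightUnitor A).hom = 𝟙 A :=
  @CocartesianStructure.inl_rightUnitor C _ S.monoidal S.symmetric S.cocartesian A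

theorem addInr_addLeftUnitor (A : C) :
    addInr (addUnit C) A ≫ (addLeftUnitor A).hom = 𝟙 A :=
  @CocartesianStructure.inr_leftUnitor C _ S.monoidal S.symmetric S.cocartesian A

end Additive

namespace DistributiveMonoidalCategory

variable {C : Type u} [Category.{v} C] [MonoidalCategory C] [S : AdditiveStructure C]
  [DistributiveMonoidalCategory C]

/-- The right distributor sends the first coprojection to the first coprojection. The right unitor
axiom settles the case of the summand `0`, and naturality reduces the general case to it. -/
theorem addInl_whiskerRight_distR (A B D : C) :
    (addInl A B ▷ D) ≫ (distR A B D).hom = addInl (A ⊗ D) (B ⊗ D) := by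
  have h0 : (addInl A (addUnit C) ▷ D) ≫ (distR A (addUnit C) D).hom =
      addInl (A ⊗ D) (addUnit C ⊗ D) := by
    refine @CocartesianStructure.eq_inl_of_comp_rightUnitor C _ S.monoidal S.symmetric
      S.cocartesian _ _ _ (annL D) ?_
    rw [Category.assoc, distR_addRightUnitor, ← comp_whiskerRight, addInl_addRightUnitor,
      id_whiskerRight]
  have h1 : addInl A B = addInl A (addUnit C) ≫ (𝟙 A ⊞ₕ S.cocartesian.cozero B) := by
    rw [addInl_addHom, Category.id_comp]
  rw [h1, comp_whiskerRight, Category.assoc, ← tensorHom_id, ← tensorHom_id, distR_naturality,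
    tensorHom_id, ← Category.assoc, h0, addInl_addHom, id_tensorHom_id, Category.id_comp]

theorem addInr_whiskerRight_distR (A B D : C) :
    (addInr A B ▷ D) ≫ (distR A B D).hom = addInr (A ⊗ D) (B ⊗ D) := by
  have h0 : (addInr (addUnit C) B ▷ D) ≫ (distR (addUnit C) B D).hom =
      addInr (addUnit C ⊗ D) (B ⊗ D) := by
    refine @CocartesianStructure.eq_inr_of_comp_leftUnitor C _ S.monoidal S.symmetric
      S.cocartesian _ _ _ (annL D) ?_
    rw [Category.assoc, distR_addLeftUnitor, ← comp_whiskerRight, addInr_addLeftUnitor,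
      id_whiskerRight]
  have h1 : addInr A B = addInr (addUnit C) B ≫ (S.cocartesian.cozero A ⊞ₕ 𝟙 B) := by
    rw [addInr_addHom, Category.id_comp]
  rw [h1, comp_whiskerRight, Category.assoc, ← tensorHom_id, ← tensorHom_id, distR_naturality,
    tensorHom_id, ← Category.assoc, h0, addInr_addHom, id_tensorHom_id, Category.id_comp]

end DistributiveMonoidalCategory

namespace PreElgotCategory

variable {C : Type u} [Category.{v} C] [MonoidalCategory C] [S : AdditiveStructure C]
  [PreElgotCategory C]

/-- The iteration `f† : A ⟶ B` of `f : A ⟶ B + A`, for the additive trace. -/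
def addIter {A B : C} (f : A ⟶ B ⊞ₒ A) : A ⟶ B :=
  @TraceStructure.iter C _ S.monoidal S.symmetric trace S.cocartesian A B f

/-- Where the step `f` exits, its iteration exits with the same value. -/
theorem comp_addIter_of_exit {X A B : C} {f : A ⟶ B ⊞ₒ A} {x : X ⟶ A} {b : X ⟶ B}
    (h : x ≫ f = b ≫ addInl B A) : x ≫ addIter f = b := by
  rw [addIter, ← @TraceStructure.comp_desc_iter C _ S.monoidal S.symmetric trace S.cocartesian,
    ← Category.assoc, h, Category.assoc, @CocartesianStructure.inl_desc C _ S.monoidal,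
    Category.comp_id]

/-- Where the step `f` continues, its iteration can be restarted from the new state. -/
theorem comp_addIter_of_continue {X A B : C} {f : A ⟶ B ⊞ₒ A} {x y : X ⟶ A}
    (h : x ≫ f = y ≫ addInr B A) : x ≫ addIter f = y ≫ addIter f := by
  conv_lhs => rw [addIter,
    ← @TraceStructure.comp_desc_iter C _ S.monoidal S.symmetric trace S.cocartesian]
  rw [← Category.assoc, h, Category.assoc, @CocartesianStructure.inr_desc C _ S.monoidal, addIter]

end PreElgotCategory

/-! ### Realizable functions between coded types -/

/-- A coding of the type `X` in the monoidal category `C`: an object `obj` and, for every element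
of `X`, a point `I ⟶ obj`. Distinct elements are allowed to have the same point. -/
class Coding (C : Type u) [Category.{v} C] [MonoidalCategory C] (X : Type) where
  obj : C
  pt : X → (𝟙_ C ⟶ obj)

namespace Coding

section Monoidal

variable {C : Type u} [Category.{v} C] [MonoidalCategory C]

instance : Coding C Unit where
  obj := 𝟙_ C
  pt _ := 𝟙 _

instance {X Y : Type} [Coding C X] [Coding C Y] : Coding C (X × Y) where
  obj := obj X ⊗ obj Y
  pt p := (λ_ (𝟙_ C)).inv ≫ (pt p.1 ⊗ₘ pt p.2)

instance {X Y : Type} [AdditiveStructure C] [Coding C X] [Coding C Y] : Coding C (X ⊕ Y) where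
  obj := obj X ⊞ₒ obj Y
  pt := Sum.elim (fun x => pt x ≫ addInl _ _) (fun y => pt y ≫ addInr _ _)

instance [AdditiveStructure C] [PreElgotCategory C] : Coding C ℕ where
  obj := PreElgotCategory.N
  pt := (PreElgotCategory.natAlgebra C).numeral

instance [AdditiveStructure C] [PreElgotCategory C] (n : ℕ) : Coding C (List.Vector ℕ n) where
  obj := tensorPow PreElgotCategory.N n
  pt := (PreElgotCategory.natAlgebra C).numerals n

end Monoidal

end Coding

open Coding

section Realizable

variable (C : Type u) [Category.{v} C] [MonoidalCategory C] {X Y Z X' Y' : Type}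
  [Coding C X] [Coding C Y] [Coding C Z] [Coding C X'] [Coding C Y']

/-- Some morphism maps the point of `x` to the point of `f x`, for every `x`. -/
def Realizable (f : X → Y) : Prop :=
  ∃ F : obj (C := C) X ⟶ obj Y, ∀ x, pt x ≫ F = pt (f x)

/-- Some morphism maps the point of `x` to the point of `f x` wherever `f` is defined; nothing is
required elsewhere. -/
def PRealizable (f : X →. Y) : Prop :=
  ∃ F : obj (C := C) X ⟶ obj Y, ∀ x, ∀ y ∈ f x, pt x ≫ F = pt y

variable {C}

theorem prealizable_coe {f : X → Y} : PRealizable C (f : X →. Y) ↔ Realizable C f := by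
  simp [PRealizable, Realizable]

theorem PRealizable.mono {f g : X →. Y} (hg : PRealizable C g) (h : ∀ x, ∀ y ∈ f x, y ∈ g x) :
    PRealizable C f :=
  hg.imp fun _ hF x y hy => hF x y (h x y hy)

theorem PRealizable.bind {f : X →. Y} {g : Y →. Z} (hf : PRealizable C f)
    (hg : PRealizable C g) : PRealizable C fun x => (f x).bind g := by
  obtain ⟨F, hF⟩ := hf
  obtain ⟨G, hG⟩ := hg
  refine ⟨F ≫ G, fun x z hz => ?_⟩
  obtain ⟨y, hy, hz⟩ := Part.mem_bind_iff.1 hz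
  rw [← Category.assoc, hF x y hy, hG y z hz]

theorem Realizable.comp {g : Y → Z} {f : X → Y} (hg : Realizable C g) (hf : Realizable C f) :
    Realizable C fun x => g (f x) := by
  obtain ⟨F, hF⟩ := hf
  obtain ⟨G, hG⟩ := hg
  exact ⟨F ≫ G, fun x => by rw [← Category.assoc, hF, hG]⟩

theorem Realizable.id : Realizable C fun x : X => x :=
  ⟨𝟙 _, fun _ => Category.comp_id _⟩

theorem PRealizable.prodMap {f : X →. Y} {g : X' →. Y'} (hf : PRealizable C f)
    (hg : PRealizable C g) :
    PRealizable C fun p : X × X' => (f p.1).bind fun y => (g p.2).map fun y' => (y, y') := by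
  obtain ⟨F, hF⟩ := hf
  obtain ⟨G, hG⟩ := hg
  refine ⟨F ⊗ₘ G, fun p q hq => ?_⟩
  obtain ⟨y, hy, hq⟩ := Part.mem_bind_iff.1 hq
  obtain ⟨y', hy', rfl⟩ := (Part.mem_map_iff _).1 hq
  simp only [pt, Category.assoc, tensorHom_comp_tensorHom, hF _ _ hy, hG _ _ hy']

theorem Realizable.prodMap {f : X → Y} {g : X' → Y'} (hf : Realizable C f)
    (hg : Realizable C g) : Realizable C fun p : X × X' => (f p.1, g p.2) :=
  prealizable_coe.1 <| ((prealizable_coe.2 hf).prodMap (prealizable_coe.2 hg)).mono (by simp)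

theorem pt_assoc (x : X) (y : Y) (z : Z) :
    pt (C := C) ((x, y), z) ≫ (α_ _ _ _).hom = pt (x, (y, z)) := by
  simp only [pt, Category.assoc, ← whiskerRight_comp_tensorHom, ← whiskerLeft_comp_tensorHom,
    associator_naturality]
  simp only [← Category.assoc]
  congr 1
  monoidal

theorem realizable_assoc : Realizable C fun p : (X × Y) × Z => (p.1.1, (p.1.2, p.2)) :=
  ⟨(α_ _ _ _).hom, fun _ => pt_assoc _ _ _⟩

theorem realizable_assoc_symm : Realizable C fun p : X × (Y × Z) => ((p.1, p.2.1), p.2.2) :=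
  ⟨(α_ _ _ _).inv, fun _ => by rw [Iso.comp_inv_eq]; exact (pt_assoc _ _ _).symm⟩

theorem realizable_unit_prod : Realizable C fun p : Unit × X => p.2 :=
  ⟨(λ_ _).hom, fun p => by simp [pt]⟩

theorem realizable_unit_prod_symm : Realizable C fun x : X => ((), x) :=
  ⟨(λ_ _).inv, fun x => by simp only [pt, leftUnitor_inv_naturality, id_tensorHom]⟩

theorem realizable_prod_unit_symm : Realizable C fun x : X => (x, ()) :=
  ⟨(ρ_ _).inv, fun x => by
    simp only [pt, rightUnitor_inv_naturality, tensorHom_id, unitors_inv_equal]⟩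

theorem Realizable.sumMap [AdditiveStructure C] {f : X → Y} {g : X' → Y'} (hf : Realizable C f)
    (hg : Realizable C g) : Realizable C (Sum.map f g) := by
  obtain ⟨F, hF⟩ := hf
  obtain ⟨G, hG⟩ := hg
  refine ⟨F ⊞ₕ G, ?_⟩
  rintro (x | x)
  · simp only [pt, Sum.map_inl, Sum.elim_inl, Category.assoc, addInl_addHom]
    rw [← Category.assoc, hF]
  · simp only [pt, Sum.map_inr, Sum.elim_inr, Category.assoc, addInr_addHom]
    rw [← Category.assoc, hG]

theorem realizable_sumProdDistrib [AdditiveStructure C] [DistributiveMonoidalCategory C] :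
    Realizable C (Equiv.sumProdDistrib X Y Z) := by
  refine ⟨(DistributiveMonoidalCategory.distR _ _ _).hom, ?_⟩
  rintro ⟨x | y, z⟩
  · simp only [pt, Sum.elim_inl, Equiv.sumProdDistrib_apply_left, Category.assoc]
    rw [← tensorHom_comp_whiskerRight_assoc,
      DistributiveMonoidalCategory.addInl_whiskerRight_distR]
    rfl
  · simp only [pt, Sum.elim_inr, Equiv.sumProdDistrib_apply_right, Category.assoc]
    rw [← tensorHom_comp_whiskerRight_assoc,
      DistributiveMonoidalCategory.addInr_whiskerRight_distR]
    rfl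

end Realizable

/-! ### Loops -/

section Iteration

variable {C : Type u} [Category.{v} C] [MonoidalCategory C] [AdditiveStructure C]
  [PreElgotCategory C] {X Y Z : Type} [Coding C X] [Coding C Y] [Coding C Z]

/-- Iteration along the additive trace realizes unbounded iteration of partial functions. -/
theorem PRealizable.fix {f : X →. Y ⊕ X} (hf : PRealizable C f) : PRealizable C f.fix := by
  obtain ⟨F, hF⟩ := hf
  refine ⟨PreElgotCategory.addIter F, fun x y hy => ?_⟩
  refine PFun.fixInduction (C := fun x => pt x ≫ PreElgotCategory.addIter F = pt y) hy ?_
  intro x hx ih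
  obtain h | ⟨x', h, -⟩ := PFun.mem_fix_iff.1 hx
  · exact PreElgotCategory.comp_addIter_of_exit (hF _ _ h)
  · rw [PreElgotCategory.comp_addIter_of_continue (hF _ _ h), ih x' h]

theorem realizable_zero : Realizable C fun _ : Unit => 0 :=
  ⟨(PreElgotCategory.natAlgebra C).zero, fun _ => Category.id_comp _⟩

theorem realizable_succ : Realizable C Nat.succ :=
  ⟨(PreElgotCategory.natAlgebra C).succ, fun _ => rfl⟩

/-- The case distinction of a natural number into zero and the successors. -/
def natCases : ℕ → Unit ⊕ ℕ
  | 0 => Sum.inl ()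
  | n + 1 => Sum.inr n

theorem realizable_natCases : Realizable C natCases := by
  refine ⟨PreElgotCategory.ι.inv, ?_⟩
  rintro (_ | n) <;> rw [Iso.comp_inv_eq]
  · exact ((Category.assoc _ _ _).trans (Category.id_comp _)).symm
  · exact (Category.assoc _ _ _).symm

/-- For-loops are realizable: the loop body runs as often as the first component says. -/
theorem Realizable.iterate {f : X → X} (hf : Realizable C f) :
    Realizable C fun p : ℕ × X => f^[p.1] p.2 := by
  let step (p : ℕ × X) : X ⊕ (ℕ × X) :=
    Sum.map (fun q : Unit × X => q.2) (fun q : ℕ × X => (q.1, f q.2))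
      (Equiv.sumProdDistrib Unit ℕ X (natCases p.1, p.2))
  have hstep : Realizable C step :=
    (realizable_unit_prod.sumMap (Realizable.id.prodMap hf)).comp
      (realizable_sumProdDistrib.comp (realizable_natCases.prodMap Realizable.id))
  refine prealizable_coe.1 ((prealizable_coe.2 hstep).fix.mono ?_)
  rintro ⟨n, x⟩ y hy
  obtain rfl : y = f^[n] x := by simpa using hy
  clear hy
  induction n generalizing x with
  | zero => exact PFun.mem_fix_iff.2 (Or.inl (by simp [step, natCases]))
  | succ n ih => exact PFun.mem_fix_iff.2 (Or.inr ⟨(n, f x), by simp [step, natCases], ih (f x)⟩)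

end Iteration

/-! ### Copying, discarding and swapping -/

/-- Codings whose elements can be copied, discarded, and moved past any other coded type. The
category `C` itself need not be cartesian or even symmetric. -/
class IsClassical (C : Type u) [Category.{v} C] [MonoidalCategory C] (X : Type) [Coding C X] :
    Prop where
  copy : Realizable C fun x : X => (x, x)
  discard : Realizable C fun _ : X => ()
  swap {Y : Type} [Coding C Y] : Realizable C fun p : X × Y => (p.2, p.1)

section Classical

variable {C : Type u} [Category.{v} C] [MonoidalCategory C]
  {X Y Z : Type} [Coding C X] [Coding C Y] [Coding C Z]

open IsClassical

/-- Each of the operations on a natural number runs a for-loop with that number as its counter: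
copying counts up two numbers from zero, discarding does nothing in its body, and swapping rebuilds
the number to the right of the other component. -/
instance [AdditiveStructure C] [PreElgotCategory C] : IsClassical C ℕ where
  copy := by
    have h : Realizable C fun n : ℕ => (n, ((0 : ℕ), (0 : ℕ))) :=
      (Realizable.id.prodMap ((realizable_zero.prodMap realizable_zero).comp
        realizable_unit_prod_symm)).comp realizable_prod_unit_symm
    have := (realizable_succ.prodMap realizable_succ).iterate.comp h
    convert this using 2 with n
    induction n with
    | zero => rfl
    | succ n ih => rw [Function.iterate_succ_apply', ← ih]
  discard := by
    simpa using (Realizable.id (X := Unit)).iterate.comp realizable_prod_unit_symm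
  swap {Y} _ := by
    have h : Realizable C fun p : ℕ × Y => (p.1, (p.2, (0 : ℕ))) :=
      Realizable.id.prodMap ((Realizable.id.prodMap realizable_zero).comp
        realizable_prod_unit_symm)
    have := ((Realizable.id (X := Y)).prodMap realizable_succ).iterate.comp h
    convert this using 2 with p
    obtain ⟨n, y⟩ := p
    induction n with
    | zero => rfl
    | succ n ih => rw [Function.iterate_succ_apply', ← ih]

theorem realizable_snd [IsClassical C X] : Realizable C fun p : X × Y => p.2 :=
  realizable_unit_prod.comp (discard.prodMap Realizable.id)

theorem realizable_fst [IsClassical C X] [IsClassical C Y] : Realizable C fun p : X × Y => p.1 :=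
  realizable_snd.comp (swap (Y := Y))

theorem PRealizable.pair [IsClassical C X] {f : X →. Y} {g : X →. Z} (hf : PRealizable C f)
    (hg : PRealizable C g) :
    PRealizable C fun x => (f x).bind fun y => (g x).map fun z => (y, z) :=
  ((prealizable_coe.2 copy).bind (hf.prodMap hg)).mono (by simp)

theorem Realizable.pair [IsClassical C X] {f : X → Y} {g : X → Z} (hf : Realizable C f)
    (hg : Realizable C g) : Realizable C fun x => (f x, g x) :=
  (hf.prodMap hg).comp copy

instance : IsClassical C Unit where
  copy := realizable_unit_prod_symm
  discard := Realizable.id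
  swap := realizable_prod_unit_symm.comp realizable_unit_prod

instance [IsClassical C X] [IsClassical C Y] : IsClassical C (X × Y) where
  copy := by
    -- `((x, x), (y, y))` is regrouped around its middle pair `(x, y)`, which is then swapped
    have h1 : Realizable C fun p : X × Y => ((p.1, p.1), (p.2, p.2)) := copy.prodMap copy
    have h2 : Realizable C fun q : X × (Y × Y) => (q.2.1, (q.1, q.2.2)) :=
      realizable_assoc.comp ((swap.prodMap Realizable.id).comp realizable_assoc_symm)
    exact realizable_assoc_symm.comp
      ((Realizable.id.prodMap h2).comp (realizable_assoc.comp h1))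
  discard := realizable_unit_prod.comp (discard.prodMap discard)
  swap {Z} _ := by
    have h1 : Realizable C fun p : (X × Y) × Z => (p.1.1, (p.2, p.1.2)) :=
      (Realizable.id.prodMap swap).comp realizable_assoc
    exact realizable_assoc.comp ((swap.prodMap Realizable.id).comp
      (realizable_assoc_symm.comp h1))

theorem IsClassical.of_leftInverse [IsClassical C Y] {e : X → Y} {e' : Y → X}
    (he : Realizable C e) (he' : Realizable C e') (h : Function.LeftInverse e' e) :
    IsClassical C X where
  copy := by simpa only [h _] using (he'.prodMap he').comp (copy.comp he)
  discard := discard.comp he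
  swap {Z} _ := by
    simpa only [h _] using (Realizable.id.prodMap he').comp
      (swap.comp (he.prodMap (Realizable.id (X := Z))))

end Classical

/-! ### Vectors of natural numbers -/

section Vectors

variable {C : Type u} [Category.{v} C] [MonoidalCategory C] [AdditiveStructure C]
  [PreElgotCategory C]

/-- The object coding vectors of length `n + 1` is by definition the one coding the pairs of a head
and a tail, with the same points. -/
theorem realizable_vector_uncons (n : ℕ) :
    Realizable C fun v : List.Vector ℕ (n + 1) =>
      ((v.head, v.tail) : ℕ × List.Vector ℕ n) :=
  ⟨𝟙 _, fun _ => Category.comp_id _⟩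

theorem realizable_vector_cons (n : ℕ) :
    Realizable C fun p : ℕ × List.Vector ℕ n => p.1 ::ᵥ p.2 :=
  ⟨𝟙 _, fun _ => Category.comp_id _⟩

theorem realizable_vector_nil :
    Realizable C fun _ : Unit => (List.Vector.nil : List.Vector ℕ 0) :=
  ⟨𝟙 _, fun _ => Category.comp_id _⟩

instance (n : ℕ) : IsClassical C (List.Vector ℕ n) := by
  induction n with
  | zero =>
    exact .of_leftInverse (e := fun _ => ()) ⟨𝟙 _, fun _ => Category.comp_id _⟩
      realizable_vector_nil fun _ => Subsingleton.elim _ _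
  | succ n ih =>
    exact .of_leftInverse (realizable_vector_uncons n) (realizable_vector_cons n)
      fun v => v.cons_head_tail

theorem realizable_vector_head (n : ℕ) :
    Realizable C fun v : List.Vector ℕ (n + 1) => v.head :=
  realizable_fst.comp (realizable_vector_uncons n)

theorem realizable_vector_tail (n : ℕ) :
    Realizable C fun v : List.Vector ℕ (n + 1) => (v.tail : List.Vector ℕ n) :=
  realizable_snd.comp (realizable_vector_uncons n)

theorem realizable_vector_get {n : ℕ} (i : Fin n) :
    Realizable C fun v : List.Vector ℕ n => v.get i := by
  induction n with
  | zero => exact i.elim0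
  | succ n ih =>
    cases i using Fin.cases with
    | zero => simpa using realizable_vector_head (C := C) n
    | succ i => simpa using (ih i).comp (realizable_vector_tail n)

theorem PRealizable.mOfFn {m n : ℕ} {g : Fin n → List.Vector ℕ m →. ℕ}
    (hg : ∀ i, PRealizable C (g i)) :
    PRealizable C fun v => List.Vector.mOfFn fun i => g i v := by
  induction n with
  | zero =>
    exact (prealizable_coe.2 (realizable_vector_nil.comp IsClassical.discard)).mono
      fun _ _ h => h
  | succ n ih =>
    refine (((hg 0).pair (ih fun i => hg i.succ)).bind
      (prealizable_coe.2 (realizable_vector_cons n))).mono ?_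
    intro v w hw
    obtain ⟨a, ha, hw⟩ := Part.mem_bind_iff.1 hw
    obtain ⟨u, hu, hw⟩ := Part.mem_bind_iff.1 hw
    exact Part.mem_bind_iff.2 ⟨(a, u), Part.mem_bind_iff.2 ⟨a, ha, Part.mem_map _ hu⟩, hw⟩

end Vectors

/-! ### Recursive functions -/

section Recursion

variable {C : Type u} [Category.{v} C] [MonoidalCategory C] [AdditiveStructure C]
  [PreElgotCategory C] {n : ℕ}

/-- Primitive recursion is a for-loop whose state holds the recursion variable, the value computed
so far, and the parameters. -/
theorem Realizable.prec {f : List.Vector ℕ n → ℕ} {g : List.Vector ℕ (n + 2) → ℕ}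
    (hf : Realizable C f) (hg : Realizable C g) :
    Realizable C fun v : List.Vector ℕ (n + 1) =>
      (v.head.rec (f v.tail) fun y IH => g (y ::ᵥ IH ::ᵥ v.tail) : ℕ) := by
  let body (s : ℕ × (ℕ × List.Vector ℕ n)) : ℕ × (ℕ × List.Vector ℕ n) :=
    (s.1.succ, (g (s.1 ::ᵥ s.2.1 ::ᵥ s.2.2), s.2.2))
  have hbody : Realizable C body :=
    (realizable_succ.comp realizable_fst).pair
      ((hg.comp ((realizable_vector_cons (n + 1)).comp
        (Realizable.id.prodMap (realizable_vector_cons n)))).pair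
          (realizable_snd.comp realizable_snd))
  have hinit : Realizable C fun w : List.Vector ℕ n => (0, (f w, w)) :=
    (realizable_zero.prodMap (hf.pair Realizable.id)).comp realizable_unit_prod_symm
  have := (realizable_fst.comp realizable_snd).comp
    (hbody.iterate.comp ((Realizable.id.prodMap hinit).comp (realizable_vector_uncons n)))
  convert this using 2 with v
  have key (k : ℕ) : body^[k] (0, (f v.tail, v.tail)) =
      (k, ((k.rec (f v.tail) fun y IH => g (y ::ᵥ IH ::ᵥ v.tail) : ℕ), v.tail)) := by
    induction k with
    | zero => rfl
    | succ k ih => rw [Function.iterate_succ_apply', ih]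
  rw [key]

/-- Unbounded search iterates a step that tests the current candidate and either exits with it or
moves on to its successor. -/
theorem PRealizable.rfind {f : List.Vector ℕ (n + 1) → ℕ} (hf : Realizable C f) :
    PRealizable C fun v : List.Vector ℕ n =>
      Nat.rfind fun k => Part.some (decide (f (k ::ᵥ v) = 0)) := by
  let step (p : ℕ × List.Vector ℕ n) : ℕ ⊕ (ℕ × List.Vector ℕ n) :=
    Sum.map (fun q : Unit × (ℕ × List.Vector ℕ n) => q.2.1)
      (fun q : ℕ × (ℕ × List.Vector ℕ n) => (q.2.1.succ, q.2.2))
      (Equiv.sumProdDistrib Unit ℕ _ (natCases (f (p.1 ::ᵥ p.2)), p))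
  have hstep : Realizable C step :=
    ((realizable_fst.comp realizable_snd).sumMap
      ((realizable_succ.prodMap Realizable.id).comp realizable_snd)).comp
        (realizable_sumProdDistrib.comp
          ((realizable_natCases.comp (hf.comp (realizable_vector_cons n))).pair Realizable.id))
  have hinit : Realizable C fun v : List.Vector ℕ n => (0, v) :=
    (realizable_zero.prodMap Realizable.id).comp realizable_unit_prod_symm
  refine ((prealizable_coe.2 hinit).bind (prealizable_coe.2 hstep).fix).mono ?_
  intro v m hm
  obtain ⟨h1, h2⟩ := Nat.mem_rfind.1 hm
  replace h1 : f (m ::ᵥ v) = 0 := by simpa using h1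
  have key {k : ℕ} (hk : k ≤ m) : m ∈ PFun.fix (step : _ →. _) (k, v) := by
    induction hk using Nat.decreasingInduction with
    | self => exact PFun.mem_fix_iff.2 (Or.inl (by simp [step, natCases, h1]))
    | of_succ k hk ih =>
      have h3 : f (k ::ᵥ v) ≠ 0 := by simpa using h2 hk
      obtain ⟨j, hj⟩ := Nat.exists_eq_succ_of_ne_zero h3
      exact PFun.mem_fix_iff.2 (Or.inr ⟨(k + 1, v), by simp [step, natCases, hj], ih⟩)
  exact Part.mem_bind_iff.2 ⟨(0, v), Part.mem_some _, key (Nat.zero_le m)⟩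

theorem realizable_of_primrec' {f : List.Vector ℕ n → ℕ} (hf : Nat.Primrec' f) :
    Realizable C f := by
  induction hf with
  | zero => exact realizable_zero.comp IsClassical.discard
  | succ => exact realizable_succ.comp (realizable_vector_head 0)
  | get i => exact realizable_vector_get i
  | comp g _ _ ihf ihg =>
    refine ihf.comp (prealizable_coe.1 ((PRealizable.mOfFn fun i =>
      prealizable_coe.2 (ihg i)).mono ?_))
    intro v w hw
    exact (List.Vector.mOfFn_pure (m := Part) fun i => g i v) ▸ hw
  | prec _ _ ihf ihg => exact ihf.prec ihg

theorem prealizable_of_partrec' {f : List.Vector ℕ n →. ℕ} (hf : Nat.Partrec' f) :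
    PRealizable C f := by
  induction hf with
  | prim hf => exact prealizable_coe.2 (realizable_of_primrec' hf)
  | comp g _ _ ihf ihg => exact (PRealizable.mOfFn ihg).bind ihf
  | rfind _ ih => exact .rfind (prealizable_coe.1 ih)

end Recursion

end Elgot

theorem mainTheorem1 (C : Type u) [Category.{v} C] [MonoidalCategory C]
    [Elgot.AdditiveStructure C] [Elgot.PreElgotCategory C] (n : ℕ) (f : List.Vector ℕ n →. ℕ) (hf : Nat.Partrec' f) :
    (Elgot.PreElgotCategory.natAlgebra C).Representable f :=
  Elgot.prealizable_of_partrec' hf
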